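/- All Hilbert spaces are complex. A bounded operator $T$ on $\mathcal H$ is a near-isometry if there is $\delta>0$ with $\delta\|x\|\le\|Tx\|\le\|x\|$ for all $x$, and $T^{*p}T^{p+1}\mathcal H\subseteq T\mathcal H$ for all $p\ge 0$. Let $\{U_{ij}\}_{1\le i<j\le n}$ be commuting unitaries on $\mathcal H$. An $n$-tuple $T=(T_1,\dots,T_n)$ of near-isometries on $\mathcal H$ is a doubly twisted near-isometry with respect to $\{U_{ij}\}$ if $T_i^*T_j=U_{ij}^*T_jT_i^*$, $T_kU_{ij}=U_{ij}T_k$ and $T_iT_j=U_{ij}T_jT_i$ for all $i<j$ and all $k$. Put $I_n=\{1,\dots,n\}$; for $B=\{b_1<\dots<b_r\}\subseteq I_n$ and $\boldsymbol k\in\mathbb N_0^{r}$ put $T_B^{\boldsymbol k}=T_{b_1}^{k_1}\cdots T_{b_r}^{k_r}$. For $A\subseteq I_n$ put $$\mathcal W_A=\bigcap_{i\in A}\ker T_i^*,\qquad \mathcal D_A=\bigcap_{\boldsymbol\ell\in\mathbb N_0^{n-|A|}}T_{I_n\setminus A}^{\boldsymbol\ell}\mathcal W_A,\qquad \mathcal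 H_A=\bigoplus_{\boldsymbol k\in\mathbb N_0^{|A|}}T_A^{\boldsymbol k}\mathcal D_A .$$ (In particular $\mathcal W_\emptyset=\mathcal H$.) For a Hilbert space $\mathcal E$, $H^2_{\mathcal E}(\mathbb D^m)$ is the Hilbert space of functions $f(z)=\sum_{\boldsymbol k}z^{\boldsymbol k}x_{\boldsymbol k}$ on the polydisc $\mathbb D^m$ with $x_{\boldsymbol k}\in\mathcal E$ and $\|f\|^2=\sum_{\boldsymbol k}\|x_{\boldsymbol k}\|^2<\infty$, and $z^{\boldsymbol k}\otimes\eta$ is the function $z\mapsto z^{\boldsymbol k}\eta$. **Theorem.** Let $T=(T_1,\dots,T_n)$ be a doubly twisted near-isometry on $\mathcal H$. Then the closed subspaces $\mathcal H_A$, $A\subseteq I_n$, form a Wold-type decomposition of $\mathcal H$ for $T$: they reduce every $T_i$, $\mathcal H=\bigoplus_{A\subseteq I_n}\mathcal H_A$, and $T_i|_{\mathcal H_A}$ is a shift operator (that is, $\mathcal H_A=\bigoplus_{p\ge0}T_i^p\mathcal W$ for some closed subspace $\mathcal W\subseteq\mathcal H_A$ with $T_i^p\mathcal W\perp T_i^q\mathcal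 W$ for all $p\neq q$) if $i\in A$, and is invertible on $\mathcal H_A$ if $i\notin A$. Fix a nonempty $A=\{a_1<\dots<a_m\}\subseteq I_n$. For $\boldsymbol k\in\mathbb N_0^m$ let $\Lambda_{A,\boldsymbol k}:\mathcal D_A\to T_A^{\boldsymbol k}\mathcal D_A$ be the unitary in the polar decomposition $T_A^{\boldsymbol k}|_{\mathcal D_A}=\Lambda_{A,\boldsymbol k}\,\bigl|T_A^{\boldsymbol k}|_{\mathcal D_A}\bigr|$. Then these unitaries exist, and there are bounded operators $M_{A,1},\dots,M_{A,n}$ on $H^2_{\mathcal D_A}(\mathbb D^{m})$ and a unitary $U_A:\mathcal H_A\to H^2_{\mathcal D_A}(\mathbb D^{m})$ such that $$U_A(T_A^{\boldsymbol k}\eta)=z^{\boldsymbol k}\otimes\Lambda_{A,\boldsymbol k}^*T_A^{\boldsymbol k}\eta\qquad(\boldsymbol k\in\mathbb N_0^m,\ \eta\in\mathcal D_A),$$ $$U_A\,T_s|_{\mathcal H_A}\,U_A^*=M_{A,s}\qquad(1\le s\le n),$$ where, for all $\boldsymbol k\in\mathbb N_0^m$ and $\eta\in\mathcal D_A$, $$M_{A,s}(z^{\boldsymbol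 k}\otimes\eta)=\begin{cases} z^{\boldsymbol k+e_i}\otimes\Lambda_{A,\boldsymbol k+e_i}^*T_{a_i}\Lambda_{A,\boldsymbol k}\eta & \text{if } s=a_i,\ 1\le i\le m,\\ z^{\boldsymbol k}\otimes\Lambda_{A,\boldsymbol k}^*T_s\Lambda_{A,\boldsymbol k}\eta & \text{if } s\notin A.\end{cases}$$ Here $T_{a_i}$ maps $T_A^{\boldsymbol k}\mathcal D_A$ into $T_A^{\boldsymbol k+e_i}\mathcal D_A$ and $T_s$ ($s\notin A$) maps $T_A^{\boldsymbol k}\mathcal D_A$ into itself, so the weights are operators on $\mathcal D_A$; they are uniformly bounded. Thus $(M_{A,a_1},\dots,M_{A,a_m})$ is an operator-valued multishift, and $M_{A,s}$ is block-diagonal for $s\notin A$. -/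

import Mathlib

open scoped InnerProductSpace

noncomputable section

namespace NearIsom

/-! ### The vector-valued Hardy space of the polydisc -/

section Hardy

/-- The open unit polydisc `𝔻^m`. -/
def polydisc (m : ℕ) : Set (Fin m → ℂ) := {z | ∀ i, ‖z i‖ < 1}

/-- The monomial `z^k = z_1^{k_1} ⋯ z_m^{k_m}`. -/
def mpow {m : ℕ} (z : Fin m → ℂ) (k : Fin m → ℕ) : ℂ := ∏ i, z i ^ k i

/-- Square-summable families of vectors of `E`, indexed by `ℕ^m`. -/
abbrev CoeffSpace (m : ℕ) (E : Type*) [NormedAddCommGroup E] : Type _ :=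
  lp (fun _ : Fin m → ℕ => E) 2

lemma one_var_coeff_eq_zero (c : ℕ → ℂ)
    (h : ∀ t : ℂ, ‖t‖ < 1 → HasSum (fun n => t ^ n * c n) 0) : c = 0 := by
  have hp : HasFPowerSeriesAt (fun _ : ℂ => (0 : ℂ)) (FormalMultilinearSeries.ofScalars ℂ c) 0 := by
    rw [hasFPowerSeriesAt_iff]
    filter_upwards [Metric.ball_mem_nhds (0 : ℂ) one_pos] with t ht
    have := h t (by simpa using ht)
    simpa [FormalMultilinearSeries.coeff_ofScalars] using this
  have h0 := hp.eq_zero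
  funext n
  have := congrArg (fun p => FormalMultilinearSeries.coeff p n) h0
  rw [FormalMultilinearSeries.coeff_ofScalars] at this
  rw [this]
  rfl

lemma slice_hasSum {κ : Type*} (e : κ → ℂ) (d : ℕ → κ → ℂ)
    (hz : ∀ t : ℂ, ‖t‖ < 1 → HasSum (fun p : ℕ × κ => t ^ p.1 * (e p.2 * d p.1 p.2)) 0) (n : ℕ) :
    HasSum (fun k => e k * d n k) 0 := by
  have hs : ∀ n, Summable (fun k => e k * d n k) := by
    intro n
    obtain ⟨t, ht, ht0⟩ : ∃ t : ℂ, ‖t‖ < 1 ∧ t ≠ 0 := ⟨1 / 2, by norm_num, by norm_num⟩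
    have h3 : Summable (fun k => t ^ n * (e k * d n k)) := (hz t ht).summable.prod_factor n
    exact (summable_mul_left_iff (pow_ne_zero n ht0)).mp h3
  have hg : (fun n => ∑' k, e k * d n k) = 0 := by
    apply one_var_coeff_eq_zero
    intro t ht
    exact (hz t ht).prod_fiberwise (fun n => (hs n).hasSum.mul_left (t ^ n))
  have h4 := (hs n).hasSum
  have h5 : ∑' k, e k * d n k = 0 := congrFun hg n
  rwa [h5] at h4

lemma scalar_coeff_eq_zero : ∀ (m : ℕ) (c : (Fin m → ℕ) → ℂ),
    (∀ z ∈ polydisc m, HasSum (fun k => mpow z k * c k) 0) → c = 0 := by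
  intro m
  induction m with
  | zero =>
    intro c h
    have h1 := h 0 (fun i => i.elim0)
    funext k
    have h2 := h1.unique (hasSum_unique _)
    rw [Subsingleton.elim k (@default _ Unique.instInhabited)]
    simpa only [mpow, Finset.univ_eq_empty, Finset.prod_empty, one_mul, Pi.zero_apply]
      using h2.symm
  | succ m ih =>
    intro c h
    have hm : ∀ (t : ℂ) (w : Fin m → ℂ) (n : ℕ) (k : Fin m → ℕ),
        mpow (Fin.cons t w : Fin (m + 1) → ℂ) (Fin.cons n k) = t ^ n * mpow w k := by
      intro t w n k
      simp [mpow, Fin.prod_univ_succ]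
    have key : ∀ (n : ℕ) (w : Fin m → ℂ), w ∈ polydisc m →
        HasSum (fun k => mpow w k * c (Fin.cons n k)) 0 := by
      intro n w hw
      have hz : ∀ t : ℂ, ‖t‖ < 1 →
          HasSum (fun p : ℕ × (Fin m → ℕ) =>
            t ^ p.1 * (mpow w p.2 * c (Fin.cons p.1 p.2))) 0 := by
        intro t ht
        have hc : (Fin.cons t w : Fin (m + 1) → ℂ) ∈ polydisc (m + 1) := by
          intro i
          cases i using Fin.cases with
          | zero => exact ht
          | succ j => exact hw j
        have h2 := (Equiv.hasSum_iff (Fin.consEquiv (fun _ : Fin (m + 1) => ℕ))).mpr (h _ hc)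
        have h3 : (fun p : ℕ × (Fin m → ℕ) =>
            t ^ p.1 * (mpow w p.2 * c (Fin.cons p.1 p.2))) =
            (fun k => mpow (Fin.cons t w : Fin (m + 1) → ℂ) k * c k) ∘
              (Fin.consEquiv (fun _ : Fin (m + 1) => ℕ)) := by
          funext p
          rw [← mul_assoc, ← hm]
          rfl
        rw [h3]
        exact h2
      exact slice_hasSum (mpow w) (fun n k => c (Fin.cons n k)) hz n
    funext k
    have h6 := ih (fun j => c (Fin.cons (k 0) j)) (key (k 0))
    have h7 := congrFun h6 (Fin.tail k)
    simpa [Fin.cons_self_tail] using h7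

variable {m : ℕ} {E : Type*} [NormedAddCommGroup E] [InnerProductSpace ℂ E]

/-- `a` is the family of power series coefficients of the function `f` on the polydisc. -/
def IsCoeff (a : CoeffSpace m E) (f : polydisc m → E) : Prop :=
  ∀ z : polydisc m, HasSum (fun k => mpow z.1 k • a k) (f z)

lemma IsCoeff.unique {a b : CoeffSpace m E} {f : polydisc m → E}
    (ha : IsCoeff a f) (hb : IsCoeff b f) : a = b := by
  ext k
  rw [← sub_eq_zero, ← inner_self_eq_zero (𝕜 := ℂ)]
  have := scalar_coeff_eq_zero m (fun j => ⟪a k - b k, a j - b j⟫_ℂ) (fun z hz => by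
    have h1 := ((ha ⟨z, hz⟩).sub (hb ⟨z, hz⟩)).mapL (innerSL ℂ (a k - b k))
    simp only [← smul_sub, innerSL_apply_apply, inner_smul_right, sub_self, inner_zero_right] at h1
    exact h1)
  exact congrFun this k

lemma IsCoeff.add {a b : CoeffSpace m E} {f g : polydisc m → E}
    (ha : IsCoeff a f) (hb : IsCoeff b g) : IsCoeff (a + b) (f + g) := fun z => by
  simpa [smul_add] using (ha z).add (hb z)

lemma IsCoeff.smul {a : CoeffSpace m E} {f : polydisc m → E} (c : ℂ)
    (ha : IsCoeff a f) : IsCoeff (c • a) (c • f) := fun z => by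
  simpa [smul_comm c] using (ha z).const_smul c

lemma IsCoeff.zero : IsCoeff (0 : CoeffSpace m E) (0 : polydisc m → E) := fun z => by
  simp

variable (m E) in
/-- The functions on the polydisc that have a power series expansion with square-summable
coefficients. -/
def hardySubmodule : Submodule ℂ (polydisc m → E) where
  carrier := {f | ∃ a : CoeffSpace m E, IsCoeff a f}
  add_mem' := fun ⟨a, ha⟩ ⟨b, hb⟩ => ⟨a + b, ha.add hb⟩
  zero_mem' := ⟨0, IsCoeff.zero⟩
  smul_mem' := fun c _ ⟨a, ha⟩ => ⟨c • a, ha.smul c⟩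

variable (m E) in
/-- The Hardy space `H²_E(𝔻^m)`: the `E`-valued functions `f(z) = ∑ z^k a_k` on the polydisc with
`∑ ‖a_k‖² < ∞`, with the inner product `⟪f, g⟫ = ∑ ⟪a_k, b_k⟫`. -/
def HardySpace : Type _ := hardySubmodule m E

namespace HardySpace

instance : AddCommGroup (HardySpace m E) := inferInstanceAs (AddCommGroup (hardySubmodule m E))

instance : Module ℂ (HardySpace m E) := inferInstanceAs (Module ℂ (hardySubmodule m E))

instance : CoeFun (HardySpace m E) (fun _ => polydisc m → E) := ⟨fun f => f.1⟩

/-- The power series coefficients of an element of the Hardy space. -/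
def coeff : HardySpace m E →ₗ[ℂ] CoeffSpace m E where
  toFun f := f.2.choose
  map_add' f g := ((f + g).2.choose_spec).unique (f.2.choose_spec.add g.2.choose_spec)
  map_smul' c f := ((c • f).2.choose_spec).unique (f.2.choose_spec.smul c)

lemma isCoeff_coeff (f : HardySpace m E) : IsCoeff (coeff f) f := f.2.choose_spec

lemma coeff_injective : Function.Injective (coeff : HardySpace m E →ₗ[ℂ] CoeffSpace m E) := by
  intro f g h
  apply Subtype.ext
  funext z
  have hf := isCoeff_coeff f z
  rw [h] at hf
  exact hf.unique (isCoeff_coeff g z)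

instance : NormedAddCommGroup (HardySpace m E) :=
  NormedAddCommGroup.induced (HardySpace m E) (CoeffSpace m E) coeff coeff_injective

instance : InnerProductSpace ℂ (HardySpace m E) where
  norm_smul_le c f := by
    change ‖coeff (c • f)‖ ≤ ‖c‖ * ‖coeff f‖
    rw [map_smul, norm_smul]
  inner f g := ⟪coeff f, coeff g⟫_ℂ
  norm_sq_eq_re_inner f := InnerProductSpace.norm_sq_eq_re_inner (𝕜 := ℂ) (coeff f)
  conj_inner_symm f g := inner_conj_symm (𝕜 := ℂ) (coeff f) (coeff g)
  add_left f g h := by rw [map_add, inner_add_left]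
  smul_left f g c := by rw [map_smul, inner_smul_left]

lemma isCoeff_single (k : Fin m → ℕ) (η : E) :
    IsCoeff (lp.single 2 k η : CoeffSpace m E) (fun z => mpow z.1 k • η) := fun z => by
  have h := hasSum_single (f := fun j => mpow z.1 j • (lp.single 2 k η : CoeffSpace m E) j) k
    (fun j hj => by simp [Pi.single_eq_of_ne hj])
  simpa [lp.coeFn_single] using h

/-- The elementary tensor `z^k ⊗ η`, that is, the function `z ↦ z^k η`. -/
def monomial (k : Fin m → ℕ) (η : E) : HardySpace m E :=
  ⟨fun z => mpow z.1 k • η, lp.single 2 k η, isCoeff_single k η⟩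

/-- `(M_1, …, M_m)` is the operator-valued multishift with weights `Γ_{k,i}`: the weights are
uniformly bounded and `M_i (z^k ⊗ η) = z_i z^k ⊗ Γ_{k,i} η`. -/
def IsMultishift (Γ : (Fin m → ℕ) → Fin m → (E →L[ℂ] E))
    (M : Fin m → (HardySpace m E →L[ℂ] HardySpace m E)) : Prop :=
  (∃ C : ℝ, ∀ k i, ‖Γ k i‖ ≤ C) ∧
    ∀ i k η, M i (monomial k η) = monomial (k + Pi.single i 1) (Γ k i η)

/-- `M` is the block-diagonal operator with weights `Γ_k`: the weights are uniformly bounded and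
`M (z^k ⊗ η) = z^k ⊗ Γ_k η`. -/
def IsBlockDiagonal (Γ : (Fin m → ℕ) → (E →L[ℂ] E))
    (M : HardySpace m E →L[ℂ] HardySpace m E) : Prop :=
  (∃ C : ℝ, ∀ k, ‖Γ k‖ ≤ C) ∧ ∀ k η, M (monomial k η) = monomial k (Γ k η)

end HardySpace

end Hardy

/-! ### Doubly twisted near-isometries and their Wold-type decomposition -/

section Operators

variable {H : Type*} [NormedAddCommGroup H] [InnerProductSpace ℂ H]

/-- The (reducing) subspace `K` is of the form `⨁ T^n W` for a wandering subspace `W`, that is,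
the restriction of `T` to `K` is a shift. -/
def IsShiftOn (T : H →L[ℂ] H) (K : Submodule ℂ H) : Prop :=
  ∃ W : Submodule ℂ H, W ≤ K ∧ IsClosed (W : Set H) ∧
    (∀ i j : ℕ, i ≠ j → W.map (T ^ i).toLinearMap ⟂ W.map (T ^ j).toLinearMap) ∧
    (⨆ i : ℕ, W.map (T ^ i).toLinearMap).topologicalClosure = K

/-- The restriction of `T` to the subspace `K` is an invertible operator on `K`. For a closed
subspace `K` of a Hilbert space the inverse is automatically bounded. -/
def IsInvertibleOn (T : H →L[ℂ] H) (K : Submodule ℂ H) : Prop := Set.BijOn T K K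

/-- `S = Λ |S|` is the polar decomposition of `S : E → H`, where `Λ` is a unitary from `E` onto
the subspace `R` of `H`; the operator `P` is `|S| = (S* S)^{1/2}`. -/
def IsPolarUnitary {E : Type*} [NormedAddCommGroup E] [InnerProductSpace ℂ E]
    (S : E →L[ℂ] H) {R : Submodule ℂ H} (Λ : E ≃ₗᵢ[ℂ] R) : Prop :=
  ∃ P : E →L[ℂ] E, P.IsPositive ∧ (∀ x y, ⟪P (P x), y⟫_ℂ = ⟪S x, S y⟫_ℂ) ∧
    ∀ x, (Λ (P x) : H) = S x

variable {n : ℕ}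

/-- `T_B^k = T_{b_1}^{k_1} ⋯ T_{b_m}^{k_m}` for `B = {b_1 < ⋯ < b_m}`. -/
def opPow (T : Fin n → (H →L[ℂ] H)) (B : Finset (Fin n)) (k : Fin B.card → ℕ) : H →L[ℂ] H :=
  (List.ofFn fun i => T (B.orderEmbOfFin rfl i) ^ k i).prod

variable [CompleteSpace H]

/-- Near-isometries. -/
structure IsNearIsometry (T : H →L[ℂ] H) : Prop where
  bounds : ∃ δ : ℝ, 0 < δ ∧ ∀ x, δ * ‖x‖ ≤ ‖T x‖ ∧ ‖T x‖ ≤ ‖x‖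
  range_le : ∀ (p : ℕ) (x : H), ∃ y, ((T.adjoint) ^ p) ((T ^ (p + 1)) x) = T y

/-- `T` is a doubly twisted near-isometry with respect to the commuting unitaries `U i j`,
`i < j` (the values of `U` at the other pairs play no role). -/
structure IsDoublyTwisted (U : Fin n → Fin n → (H →L[ℂ] H)) (T : Fin n → (H →L[ℂ] H)) :
    Prop where
  unitary : ∀ i j, i < j → U i j ∈ unitary (H →L[ℂ] H)
  commute : ∀ i j p q, i < j → p < q → U i j * U p q = U p q * U i j
  nearIsometry : ∀ i, IsNearIsometry (T i)
  adjoint_mul : ∀ i j, i < j → (T i).adjoint * T j = (U i j).adjoint * T j * (T i).adjoint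
  mul_unitary : ∀ i j k, i < j → T k * U i j = U i j * T k
  mul_mul : ∀ i j, i < j → T i * T j = U i j * T j * T i

/-- `W_A`, the intersection of the kernels of `T_i*`, `i ∈ A`. -/
def kerSubspace (T : Fin n → (H →L[ℂ] H)) (A : Finset (Fin n)) : Submodule ℂ H :=
  ⨅ i ∈ A, (T i).adjoint.ker

/-- The `A`-wandering subspace `D_A = ⋂_ℓ T_{I∖A}^ℓ W_A`. -/
def wandering (T : Fin n → (H →L[ℂ] H)) (A : Finset (Fin n)) : Submodule ℂ H :=
  ⨅ l : Fin Aᶜ.card → ℕ, (kerSubspace T A).map (opPow T Aᶜ l).toLinearMap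

/-- The subspace `T_A^k D_A`. -/
def block (T : Fin n → (H →L[ℂ] H)) (A : Finset (Fin n)) (k : Fin A.card → ℕ) :
    Submodule ℂ H :=
  (wandering T A).map (opPow T A k).toLinearMap

/-- The Wold summand `H_A = ⨁_k T_A^k D_A`. -/
def woldSummand (T : Fin n → (H →L[ℂ] H)) (A : Finset (Fin n)) : Submodule ℂ H :=
  (⨆ k, block T A k).topologicalClosure

/-- The family `K` of closed subspaces is a Wold-type decomposition for `T`. -/
structure IsWoldDecomposition (T : Fin n → (H →L[ℂ] H))
    (K : Finset (Fin n) → Submodule ℂ H) : Prop where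
  closed : ∀ A, IsClosed (K A : Set H)
  reducing : ∀ A i, ∀ x ∈ K A, T i x ∈ K A ∧ (T i).adjoint x ∈ K A
  orthogonal : ∀ A B, A ≠ B → K A ⟂ K B
  span : ⨆ A, K A = ⊤
  shift : ∀ A, ∀ i ∈ A, IsShiftOn (T i) (K A)
  invertible : ∀ A, ∀ i ∉ A, IsInvertibleOn (T i) (K A)

variable (T : Fin n → (H →L[ℂ] H)) (A : Finset (Fin n))

/-- `T_A^k η` as an element of `T_A^k D_A`. -/
def toBlock (k : Fin A.card → ℕ) (η : wandering T A) : block T A k :=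
  ⟨opPow T A k η, Submodule.mem_map_of_mem η.2⟩

lemma block_le_woldSummand (k : Fin A.card → ℕ) : block T A k ≤ woldSummand T A :=
  (le_iSup (block T A) k).trans (Submodule.le_topologicalClosure _)

/-- `T_A^k η` as an element of `H_A`. -/
def toSummand (k : Fin A.card → ℕ) (η : wandering T A) : woldSummand T A :=
  ⟨opPow T A k η, block_le_woldSummand T A k (toBlock T A k η).2⟩

variable {T A}

/-- The operator `Λ_l* S Λ_k` on `D_A`, for an operator `S` that maps `T_A^k D_A` into
`T_A^l D_A`; here `Λ_l* = Λ_l⁻¹ : T_A^l D_A → D_A`. -/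
def weight (Λ : ∀ k, wandering T A ≃ₗᵢ[ℂ] block T A k) (S : H →L[ℂ] H)
    (k l : Fin A.card → ℕ) (h : Set.MapsTo S (block T A k) (block T A l)) :
    wandering T A →L[ℂ] wandering T A :=
  ((Λ l).symm : block T A l →L[ℂ] wandering T A) ∘L S.restrict h ∘L
    (Λ k : wandering T A →L[ℂ] block T A k)

end Operators

end NearIsom

end

noncomputable section

namespace NearIsom

/-! ### Reducing subspaces -/

section Reducing

variable {H : Type*} [NormedAddCommGroup H] [InnerProductSpace ℂ H]

/-! For one near-isometry `T`, the condition on `T*^p T^(p+1)` says exactly that `T^p ker T*` is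
orthogonal to the range of `T^(p+1)`. Since `T` is bounded below, its range is closed, so `ran T^p =
T^p ker T* ⊕ ran T^(p+1)` orthogonally. Hence the levels `T^p ker T*` are pairwise orthogonal, and
the orthogonal complement of their closed span `shiftPart T` is the intersection `core T` of the
ranges (`core_eq`). Both parts reduce `T`, which is a shift on the first and invertible on the
second.

For a tuple, the twisting relations make every level and the core of `T_i` reducing for each `T_j`,
`j ≠ i` (`IsDoublyTwisted.twists`). Products of powers can then be replaced by intersections: `T_A^k
D_A` is the intersection of the `k_r`-th levels of the `T_{a_r}` with the cores of the remaining
operators (`block_eq`), and `H_A` is the intersection of the shift parts for `i ∈ A` and the cores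
for `i ∉ A` (`woldSummand_eq`). Splitting along one index after another gives the decomposition of
the whole space.

For the model, `T_A^k` is bounded below on `D_A`, so its polar part `Λ_k` is a unitary onto the
block (`exists_isPolarUnitary`). The blocks are orthogonal with closed span `H_A`, so the `Λ_k`
assemble into a unitary onto the Hardy space (`exists_equiv_of_blocks`). Each `T_s` maps blocks to
blocks, and the weights are contractions because the `Λ_k` are isometric and `‖T_s‖ ≤ 1`. -/

lemma eq_zero_of_mem_orthogonal {K : Submodule ℂ H} {x : H} (h : x ∈ K) (h' : x ∈ Kᗮ) :
    x = 0 := by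
  have := h' x h
  rwa [inner_self_eq_zero] at this

lemma eq_of_add_eq_add {K : Submodule ℂ H} {a b c d : H} (ha : a ∈ K) (hb : b ∈ Kᗮ)
    (hc : c ∈ K) (hd : d ∈ Kᗮ) (h : a + b = c + d) : a = c := by
  have h1 : a - c = d - b := by
    rw [sub_eq_sub_iff_add_eq_add, h, add_comm]
  have h2 : a - c = 0 :=
    eq_zero_of_mem_orthogonal (K.sub_mem ha hc) (h1 ▸ Kᗮ.sub_mem hd hb)
  exact sub_eq_zero.mp h2

lemma isClosed_iInf {ι : Sort*} {K : ι → Submodule ℂ H} (h : ∀ i, IsClosed (K i : Set H)) :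
    IsClosed ((⨅ i, K i : Submodule ℂ H) : Set H) := by
  rw [Submodule.coe_iInf]
  exact isClosed_iInter h

variable [CompleteSpace H]

/-- The closed subspace `K` reduces the operator `S`. -/
structure Reduces (S : H →L[ℂ] H) (K : Submodule ℂ H) : Prop where
  closed : IsClosed (K : Set H)
  map_mem : ∀ x ∈ K, S x ∈ K
  adjoint_mem : ∀ x ∈ K, S.adjoint x ∈ K

lemma exists_add_of_isClosed {K : Submodule ℂ H} (hK : IsClosed (K : Set H)) (x : H) :
    ∃ a ∈ K, ∃ b ∈ Kᗮ, x = a + b := by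
  have : CompleteSpace K := hK.completeSpace_coe
  exact Submodule.exists_add_mem_mem_orthogonal x

namespace Reduces

variable {S T : H →L[ℂ] H} {K L : Submodule ℂ H}

lemma orthogonal (h : Reduces S K) : Reduces S Kᗮ where
  closed := K.isClosed_orthogonal
  map_mem x hx := by
    intro u hu
    rw [← ContinuousLinearMap.adjoint_inner_left]
    exact hx _ (h.adjoint_mem u hu)
  adjoint_mem x hx := by
    intro u hu
    rw [ContinuousLinearMap.adjoint_inner_right]
    exact hx _ (h.map_mem u hu)

lemma of_map_orthogonal (hK : IsClosed (K : Set H)) (h : ∀ x ∈ K, S x ∈ K)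
    (h' : ∀ x ∈ Kᗮ, S x ∈ Kᗮ) : Reduces S K where
  closed := hK
  map_mem := h
  adjoint_mem x hx := by
    have : CompleteSpace K := hK.completeSpace_coe
    rw [← K.orthogonal_orthogonal]
    intro u hu
    rw [ContinuousLinearMap.adjoint_inner_right]
    exact (Submodule.mem_orthogonal' _ _).mp (h' u hu) x hx

lemma inf (hK : Reduces S K) (hL : Reduces S L) : Reduces S (K ⊓ L) where
  closed := hK.closed.inter hL.closed
  map_mem x hx := ⟨hK.map_mem x hx.1, hL.map_mem x hx.2⟩
  adjoint_mem x hx := ⟨hK.adjoint_mem x hx.1, hL.adjoint_mem x hx.2⟩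

lemma iInf {ι : Sort*} {K : ι → Submodule ℂ H} (h : ∀ i, Reduces S (K i)) :
    Reduces S (⨅ i, K i) where
  closed := isClosed_iInf fun i => (h i).closed
  map_mem x hx := by
    rw [Submodule.mem_iInf] at hx ⊢
    exact fun i => (h i).map_mem x (hx i)
  adjoint_mem x hx := by
    rw [Submodule.mem_iInf] at hx ⊢
    exact fun i => (h i).adjoint_mem x (hx i)

lemma pow_mem (h : Reduces S K) (p : ℕ) : ∀ x ∈ K, (S ^ p) x ∈ K := by
  induction p with
  | zero =>
    intro x hx
    simpa using hx
  | succ p ih =>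
    intro x hx
    rw [pow_succ']
    exact h.map_mem _ (ih x hx)

/-- The `Kᗮ`-component of `x` is sent by `S ^ p` into both `K` and `Kᗮ`, hence to zero, and
injectivity kills it. -/
lemma mem_of_pow_mem (h : Reduces S K) {p : ℕ} (hS : Function.Injective (S ^ p)) {x : H}
    (hx : (S ^ p) x ∈ K) : x ∈ K := by
  obtain ⟨a, ha, b, hb, rfl⟩ := exists_add_of_isClosed h.closed x
  have h1 : (S ^ p) b ∈ K := by
    have := K.sub_mem hx (h.pow_mem p a ha)
    rwa [map_add, add_sub_cancel_left] at this
  have h2 : (S ^ p) b = (S ^ p) 0 := by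
    rw [map_zero]
    exact eq_zero_of_mem_orthogonal h1 (h.orthogonal.pow_mem p b hb)
  rw [hS h2, add_zero]
  exact ha

lemma mem_ker_adjoint_of_add (h : Reduces S K) {a b : H} (ha : a ∈ K) (hb : b ∈ Kᗮ)
    (hab : S.adjoint (a + b) = 0) : S.adjoint a = 0 := by
  refine eq_of_add_eq_add (h.adjoint_mem a ha) (h.orthogonal.adjoint_mem b hb) K.zero_mem
    Kᗮ.zero_mem ?_
  rw [← map_add, hab, add_zero]

end Reduces

end Reducing

/-! ### The Wold decomposition of a single near-isometry -/

section Single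

variable {H : Type*} [NormedAddCommGroup H] [InnerProductSpace ℂ H] [CompleteSpace H]

/-- The subspace `T^p ker T*`. -/
def level (T : H →L[ℂ] H) (p : ℕ) : Submodule ℂ H := T.adjoint.ker.map (T ^ p).toLinearMap

/-- The closed span of the subspaces `T^p ker T*`. -/
def shiftPart (T : H →L[ℂ] H) : Submodule ℂ H := (⨆ p, level T p).topologicalClosure

/-- The intersection of the ranges of the powers of `T`. -/
def core (T : H →L[ℂ] H) : Submodule ℂ H := ⨅ p : ℕ, (T ^ p).range

variable {T : H →L[ℂ] H}

lemma mem_level {p : ℕ} {x : H} : x ∈ level T p ↔ ∃ w, T.adjoint w = 0 ∧ (T ^ p) w = x := Iff.rfl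

omit [CompleteSpace H] in
lemma mem_core {x : H} : x ∈ core T ↔ ∀ p : ℕ, ∃ y, (T ^ p) y = x := by
  rw [core, Submodule.mem_iInf]
  rfl

lemma level_zero : level T 0 = T.adjoint.ker := by
  ext x
  simp [mem_level]

lemma level_le_shiftPart (p : ℕ) : level T p ≤ shiftPart T :=
  (le_iSup (level T) p).trans (Submodule.le_topologicalClosure _)

lemma isClosed_shiftPart : IsClosed (shiftPart T : Set H) := Submodule.isClosed_topologicalClosure _

lemma inner_ker_adjoint_apply {w : H} (hw : T.adjoint w = 0) (y : H) : ⟪w, T y⟫_ℂ = 0 := by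
  rw [← ContinuousLinearMap.adjoint_inner_left, hw, inner_zero_left]

lemma adjoint_pow_apply_inner (p : ℕ) (x y : H) :
    ⟪(T ^ p) x, y⟫_ℂ = ⟪x, (T.adjoint ^ p) y⟫_ℂ := by
  induction p generalizing x with
  | zero => simp
  | succ p ih =>
    rw [pow_succ, mul_apply_eq_comp, ih, pow_succ', mul_apply_eq_comp,
      ContinuousLinearMap.adjoint_inner_right]

lemma apply_mem_level_succ {p : ℕ} {x : H} (hx : x ∈ level T p) : T x ∈ level T (p + 1) := by
  obtain ⟨w, hw, rfl⟩ := mem_level.mp hx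
  exact ⟨w, hw, by rw [pow_succ']; rfl⟩

/-- Intersection does not distribute over closed spans in general. Here it does because `K` reduces
`T`: a vector `w` of `ker T*` splits along `K ⊕ Kᗮ` into vectors of `ker T*`, so a `v ∈ K`
orthogonal to all `K ⊓ level T p` is orthogonal to every `T^p w`. -/
lemma Reduces.inf_shiftPart {K : Submodule ℂ H} (hK : Reduces T K) :
    K ⊓ shiftPart T = (⨆ p, K ⊓ level T p).topologicalClosure := by
  have hle : (⨆ p, K ⊓ level T p).topologicalClosure ≤ K ⊓ shiftPart T :=
    Submodule.topologicalClosure_minimal _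
      (iSup_le fun p => inf_le_inf_left _ (level_le_shiftPart p))
      (hK.closed.inter isClosed_shiftPart)
  refine le_antisymm (fun x hx => ?_) hle
  obtain ⟨u, hu, v, hv, rfl⟩ :=
    exists_add_of_isClosed (Submodule.isClosed_topologicalClosure (⨆ p, K ⊓ level T p)) x
  have hv' : v ∈ K ⊓ shiftPart T := by
    simpa using Submodule.sub_mem _ hx (hle hu)
  have hv0 : v ∈ (shiftPart T)ᗮ := by
    rw [shiftPart, Submodule.orthogonal_closure, ← Submodule.iInf_orthogonal, Submodule.mem_iInf]
    rintro p _ ⟨w, hw, rfl⟩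
    obtain ⟨a, ha, b, hb, rfl⟩ := exists_add_of_isClosed hK.closed w
    have h1 : (T ^ p) a ∈ K ⊓ level T p :=
      ⟨hK.pow_mem p a ha, a, hK.mem_ker_adjoint_of_add ha hb hw, rfl⟩
    have h2 := hv _ (Submodule.le_topologicalClosure _ (Submodule.mem_iSup_of_mem p h1))
    have h3 := (Submodule.mem_orthogonal' _ _).mp (hK.orthogonal.pow_mem p b hb) v hv'.1
    rw [ContinuousLinearMap.coe_coe, map_add, inner_add_left, h2, h3, add_zero]
  rw [eq_zero_of_mem_orthogonal hv'.2 hv0, add_zero]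
  exact hu

namespace IsNearIsometry

lemma pow_bound (hT : IsNearIsometry T) (p : ℕ) :
    ∃ δ : ℝ, 0 < δ ∧ ∀ x, δ * ‖x‖ ≤ ‖(T ^ p) x‖ := by
  obtain ⟨δ, hδ, h⟩ := hT.bounds
  refine ⟨δ ^ p, pow_pos hδ p, ?_⟩
  induction p with
  | zero => simp
  | succ p ih =>
    intro x
    rw [pow_succ', pow_succ, mul_apply_eq_comp]
    calc δ * δ ^ p * ‖x‖ = δ ^ p * (δ * ‖x‖) := by ring
      _ ≤ δ ^ p * ‖T x‖ := by gcongr; exact (h x).1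
      _ ≤ _ := ih _

lemma pow_antilipschitz (hT : IsNearIsometry T) (p : ℕ) :
    ∃ C, AntilipschitzWith C (T ^ p) := by
  obtain ⟨δ, hδ, h⟩ := hT.pow_bound p
  refine ⟨δ⁻¹.toNNReal, ContinuousLinearMap.antilipschitz_of_bound _ fun x => ?_⟩
  rw [Real.coe_toNNReal _ (by positivity), inv_mul_eq_div, le_div_iff₀' hδ]
  exact h x

lemma pow_injective (hT : IsNearIsometry T) (p : ℕ) : Function.Injective (T ^ p) :=
  (hT.pow_antilipschitz p).choose_spec.injective

lemma injective (hT : IsNearIsometry T) : Function.Injective T := by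
  simpa using hT.pow_injective 1

lemma isClosed_map_pow (hT : IsNearIsometry T) (p : ℕ) {K : Submodule ℂ H}
    (hK : IsClosed (K : Set H)) : IsClosed (K.map (T ^ p).toLinearMap : Set H) := by
  obtain ⟨C, hC⟩ := hT.pow_antilipschitz p
  exact (hC.isClosedEmbedding (T ^ p).uniformContinuous).isClosedMap _ hK

lemma isClosed_level (hT : IsNearIsometry T) (p : ℕ) : IsClosed (level T p : Set H) :=
  hT.isClosed_map_pow p T.adjoint.isClosed_ker

/-- The only place where the range condition on a near-isometry enters: moving `T^p` across the
inner product leaves `w ∈ ker T*` paired with a vector of `ran T`. -/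
lemma inner_level_pow (hT : IsNearIsometry T) {p q : ℕ} (hpq : p < q) {x : H}
    (hx : x ∈ level T p) (y : H) : ⟪x, (T ^ q) y⟫_ℂ = 0 := by
  obtain ⟨w, hw, rfl⟩ := mem_level.mp hx
  obtain ⟨r, rfl⟩ := Nat.exists_eq_add_of_lt hpq
  obtain ⟨z, hz⟩ := hT.range_le p ((T ^ r) y)
  rw [adjoint_pow_apply_inner, show p + r + 1 = p + 1 + r by ring, pow_add,
    mul_apply_eq_comp, hz]
  exact inner_ker_adjoint_apply hw z

lemma level_isOrtho (hT : IsNearIsometry T) {p q : ℕ} (hpq : p ≠ q) :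
    level T p ⟂ level T q := by
  rcases lt_or_gt_of_ne hpq with h | h
  · rw [Submodule.isOrtho_iff_inner_eq]
    rintro x hx _ ⟨w, _, rfl⟩
    exact hT.inner_level_pow h hx w
  · rw [Submodule.isOrtho_comm, Submodule.isOrtho_iff_inner_eq]
    rintro x hx _ ⟨w, _, rfl⟩
    exact hT.inner_level_pow h hx w

/-- Apply `T^p` to the decomposition `H = ran T ⊕ ker T*`, valid because the range is closed. -/
lemma exists_level_add (hT : IsNearIsometry T) (p : ℕ) (x : H) :
    ∃ a ∈ level T p, ∃ y, (T ^ p) x = a + (T ^ (p + 1)) y := by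
  have hcl : IsClosed (T.range : Set H) := by
    have := hT.isClosed_map_pow 1 (K := ⊤) isClosed_univ
    rwa [pow_one, Submodule.map_top] at this
  obtain ⟨_, ⟨y, rfl⟩, w, hw, rfl⟩ := exists_add_of_isClosed hcl x
  rw [ContinuousLinearMap.orthogonal_range] at hw
  refine ⟨(T ^ p) w, ⟨w, hw, rfl⟩, y, ?_⟩
  rw [map_add, add_comm, pow_succ]
  rfl

lemma core_eq (hT : IsNearIsometry T) : core T = (shiftPart T)ᗮ := by
  rw [shiftPart, Submodule.orthogonal_closure, ← Submodule.iInf_orthogonal]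
  apply le_antisymm
  · refine le_iInf fun p x hx w hw => ?_
    obtain ⟨y, rfl⟩ := mem_core.mp hx (p + 1)
    exact hT.inner_level_pow p.lt_succ_self hw y
  · intro x hx
    rw [Submodule.mem_iInf] at hx
    rw [mem_core]
    intro p
    induction p with
    | zero => exact ⟨x, by simp⟩
    | succ p ih =>
      obtain ⟨y, hy⟩ := ih
      obtain ⟨a, ha, z, hz⟩ := hT.exists_level_add p y
      -- The level component `a` of `x` is orthogonal to `x` and to the remainder in `ran T^(p+1)`,
      -- so `⟪a, a⟫ = 0` and `x` itself lies in that range.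
      have h1 := hx p a ha
      rw [← hy, hz, inner_add_right, hT.inner_level_pow p.lt_succ_self ha, add_zero,
        inner_self_eq_zero] at h1
      exact ⟨z, by rw [← hy, hz, h1, zero_add]⟩

lemma core_orthogonal (hT : IsNearIsometry T) : (core T)ᗮ = shiftPart T := by
  have : CompleteSpace (shiftPart T) := isClosed_shiftPart.completeSpace_coe
  rw [hT.core_eq, Submodule.orthogonal_orthogonal]

lemma shiftPart_isOrtho_core (hT : IsNearIsometry T) : shiftPart T ⟂ core T := by
  rw [hT.core_eq]
  exact Submodule.isOrtho_orthogonal_right _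

lemma isClosed_core (hT : IsNearIsometry T) : IsClosed (core T : Set H) := by
  rw [hT.core_eq]
  exact Submodule.isClosed_orthogonal _

/-- Invariance under the adjoint comes from invariance of the complement under `T`: the complement
is the shift part, whose levels `T` raises by one. -/
lemma reduces_core (hT : IsNearIsometry T) : Reduces T (core T) := by
  refine .of_map_orthogonal hT.isClosed_core ?_ ?_
  · intro x hx
    rw [mem_core] at hx ⊢
    intro p
    obtain ⟨y, rfl⟩ := hx p
    refine ⟨T y, ?_⟩
    rw [← mul_apply_eq_comp, ← mul_apply_eq_comp, ← pow_succ, pow_succ']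
  · rw [hT.core_orthogonal]
    have h : shiftPart T ≤ (shiftPart T).comap T.toLinearMap := by
      refine Submodule.topologicalClosure_minimal _ (iSup_le fun p x hx => ?_)
        (isClosed_shiftPart.preimage T.continuous)
      exact level_le_shiftPart _ (apply_mem_level_succ hx)
    exact h

lemma reduces_shiftPart (hT : IsNearIsometry T) : Reduces T (shiftPart T) :=
  hT.core_orthogonal ▸ hT.reduces_core.orthogonal

/-- `T` maps onto every reducing subspace of its core. -/
lemma exists_pow_of_le_core (hT : IsNearIsometry T) {K : Submodule ℂ H} (hK : Reduces T K)
    (h : K ≤ core T) (p : ℕ) {x : H} (hx : x ∈ K) : ∃ y ∈ K, (T ^ p) y = x := by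
  obtain ⟨y, rfl⟩ := mem_core.mp (h hx) p
  exact ⟨y, hK.mem_of_pow_mem (hT.pow_injective p) hx, rfl⟩

lemma isInvertibleOn (hT : IsNearIsometry T) {K : Submodule ℂ H} (hK : Reduces T K)
    (h : K ≤ core T) : IsInvertibleOn T K := by
  refine ⟨hK.map_mem, hT.injective.injOn, fun x hx => ?_⟩
  obtain ⟨y, hy, hxy⟩ := hT.exists_pow_of_le_core hK h 1 hx
  exact ⟨y, hy, by simpa using hxy⟩

lemma map_pow_inf_ker (hT : IsNearIsometry T) {K : Submodule ℂ H} (hK : Reduces T K) (p : ℕ) :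
    (K ⊓ T.adjoint.ker).map (T ^ p).toLinearMap = K ⊓ level T p := by
  apply le_antisymm
  · rintro _ ⟨w, ⟨hw, hw'⟩, rfl⟩
    exact ⟨hK.pow_mem p w hw, w, hw', rfl⟩
  · rintro _ ⟨hx, w, hw, rfl⟩
    exact ⟨w, ⟨hK.mem_of_pow_mem (hT.pow_injective p) hx, hw⟩, rfl⟩

lemma isShiftOn (hT : IsNearIsometry T) {K : Submodule ℂ H} (hK : Reduces T K)
    (h : K ≤ shiftPart T) : IsShiftOn T K := by
  refine ⟨K ⊓ T.adjoint.ker, inf_le_left, hK.closed.inter T.adjoint.isClosed_ker, ?_, ?_⟩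
  · intro i j hij
    rw [hT.map_pow_inf_ker hK, hT.map_pow_inf_ker hK]
    exact (hT.level_isOrtho hij).mono inf_le_right inf_le_right
  · simp_rw [hT.map_pow_inf_ker hK]
    rw [← hK.inf_shiftPart, inf_eq_left.mpr h]

/-- The projections onto `K` and onto the core are compatible: since `T^p` preserves `K` and `Kᗮ`,
the `K`-component of a core vector is again a core vector. -/
lemma exists_shiftPart_add_core (hT : IsNearIsometry T) {K : Submodule ℂ H} (hK : Reduces T K)
    {x : H} (hx : x ∈ K) : ∃ a ∈ K ⊓ shiftPart T, ∃ b ∈ K ⊓ core T, x = a + b := by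
  have hcore : ∀ u ∈ K, ∀ v ∈ Kᗮ, u + v ∈ core T → u ∈ core T := by
    intro u hu v hv h
    rw [mem_core] at h ⊢
    intro p
    obtain ⟨y, hy⟩ := h p
    obtain ⟨a, ha, b, hb, rfl⟩ := exists_add_of_isClosed hK.closed y
    refine ⟨a, eq_of_add_eq_add (hK.pow_mem p a ha) (hK.orthogonal.pow_mem p b hb) hu hv ?_⟩
    rw [← map_add, hy]
  obtain ⟨b, hb, a, ha, rfl⟩ := exists_add_of_isClosed hT.isClosed_core x
  obtain ⟨b₁, hb₁, b₂, hb₂, rfl⟩ := exists_add_of_isClosed hK.closed b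
  have h1 := hcore b₁ hb₁ b₂ hb₂ hb
  have h2 : b₂ ∈ core T := by simpa using Submodule.sub_mem _ hb h1
  have h3 : b₂ + a ∈ K := by
    have := K.sub_mem hx hb₁
    rwa [add_assoc, add_sub_cancel_left] at this
  -- `b₂ + a` lies in `K` while `b₂ ∈ Kᗮ`, and `a` is orthogonal to the core vector `b₂`.
  have h4 : b₂ = 0 := by
    have h5 : ⟪b₂, b₂ + a⟫_ℂ = 0 := (Submodule.mem_orthogonal' _ _).mp hb₂ _ h3
    rw [inner_add_right, ha b₂ h2, add_zero, inner_self_eq_zero] at h5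
    exact h5
  subst h4
  rw [zero_add] at h3
  rw [hT.core_orthogonal] at ha
  exact ⟨a, ⟨h3, ha⟩, b₁, ⟨hb₁, h1⟩, by rw [add_zero, add_comm]⟩

end IsNearIsometry

end Single

/-! ### Twisted pairs of operators -/

section Twists

variable {H : Type*} [NormedAddCommGroup H] [InnerProductSpace ℂ H] [CompleteSpace H]

/-- `S` commutes with `T` up to an operator commuting with `T` and `T*`, and `T* S` is a left
multiple of `S T*`. -/
def Twists (S T : H →L[ℂ] H) : Prop :=
  ∃ V W : H →L[ℂ] H, S * T = V * T * S ∧ Commute V T ∧ Commute V T.adjoint ∧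
    T.adjoint * S = W * S * T.adjoint

namespace Twists

variable {S T : H →L[ℂ] H}

/-- As `V` commutes with `T`, `S T^p = (V T)^p S = T^p V^p S`, so `y = V^p S x` works. It stays in
`ker T*` because `T* V^p S = V^p W S T*`. -/
lemma exists_apply_pow (h : Twists S T) (p : ℕ) (x : H) :
    ∃ y, S ((T ^ p) x) = (T ^ p) y ∧ (T.adjoint x = 0 → T.adjoint y = 0) := by
  obtain ⟨V, W, hV, hVT, hVT', hW⟩ := h
  have h1 : S * T ^ p = T ^ p * (V ^ p * S) := by
    have h2 : SemiconjBy S (T ^ p) ((V * T) ^ p) := SemiconjBy.pow_right hV p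
    rw [h2.eq, hVT.mul_pow, (hVT.pow_pow p p).eq, mul_assoc]
  refine ⟨(V ^ p * S) x, DFunLike.congr_fun h1 x, fun hx => ?_⟩
  have h3 : T.adjoint * (V ^ p * S) = V ^ p * W * S * T.adjoint := by
    rw [← mul_assoc, ← (hVT'.pow_left p).eq, mul_assoc, hW]
    simp only [mul_assoc]
  have h4 := DFunLike.congr_fun h3 x
  simpa [hx] using h4

lemma apply_mem_level (h : Twists S T) {p : ℕ} {x : H} (hx : x ∈ level T p) :
    S x ∈ level T p := by
  obtain ⟨w, hw, rfl⟩ := mem_level.mp hx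
  obtain ⟨y, hy, hy'⟩ := h.exists_apply_pow p w
  exact ⟨y, hy' hw, hy.symm⟩

lemma apply_mem_core (h : Twists S T) {x : H} (hx : x ∈ core T) : S x ∈ core T := by
  rw [mem_core] at hx ⊢
  intro p
  obtain ⟨w, rfl⟩ := hx p
  obtain ⟨y, hy, -⟩ := h.exists_apply_pow p w
  exact ⟨y, hy.symm⟩

end Twists

end Twists

/-! ### Doubly twisted near-isometries -/

section Tuples

variable {n : ℕ} {H : Type*} [NormedAddCommGroup H] [InnerProductSpace ℂ H] [CompleteSpace H]
  {U : Fin n → Fin n → (H →L[ℂ] H)} {T : Fin n → (H →L[ℂ] H)}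

lemma commute_star_of_unitary {M : Type*} [Monoid M] [StarMul M] {u a : M} (hu : u ∈ unitary M)
    (h : Commute u a) : Commute (star u) a := by
  change star u * a = a * star u
  calc star u * a = star u * (a * (u * star u)) := by
        rw [(Unitary.mem_iff.mp hu).2, mul_one]
    _ = star u * (u * a) * star u := by rw [h.eq]; simp only [mul_assoc]
    _ = a * star u := by rw [← mul_assoc, (Unitary.mem_iff.mp hu).1, one_mul]

/-- Removes the ordering of the indices: for `j < i` the twist is `U_{ji}*`, and the mixed relation
is the adjoint of the given one. -/
lemma IsDoublyTwisted.exists_twist (hT : IsDoublyTwisted U T) {i j : Fin n} (hij : i ≠ j) :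
    ∃ V : H →L[ℂ] H, V ∈ _root_.unitary (H →L[ℂ] H) ∧ (∀ k, Commute V (T k)) ∧
      T i * T j = V * T j * T i ∧ star (T i) * T j = star V * T j * star (T i) := by
  rcases lt_or_gt_of_ne hij with h | h
  · refine ⟨U i j, hT.unitary i j h, fun k => (hT.mul_unitary i j k h).symm, hT.mul_mul i j h, ?_⟩
    exact hT.adjoint_mul i j h
  · have hu := hT.unitary j i h
    have hc : ∀ k, Commute (U j i) (T k) := fun k => (hT.mul_unitary j i k h).symm
    have hc' : ∀ k, Commute (star (U j i)) (T k) := fun k => commute_star_of_unitary hu (hc k)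
    refine ⟨star (U j i), Unitary.star_mem hu, hc', ?_, ?_⟩
    · rw [mul_assoc, hT.mul_mul j i h, mul_assoc, ← mul_assoc (star _),
        (Unitary.mem_iff.mp hu).1, one_mul]
    · have h1 : star (T j) * T i = star (U j i) * T i * star (T j) := hT.adjoint_mul j i h
      have h2 := congrArg star h1
      simp only [star_mul, star_star] at h2
      have h3 : Commute (U j i) (star (T i)) := by simpa using (hc' i).star_star
      rw [h2, star_star, ← h3.eq, ← mul_assoc, ← (hc j).eq]

/-- Having both `T_j` and `T_j*` twist with `T_i` is what makes the levels and the core of `T_i`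
reducing for `T_j`. -/
lemma IsDoublyTwisted.twists (hT : IsDoublyTwisted U T) {i j : Fin n} (hij : i ≠ j) :
    Twists (T j) (T i) ∧ Twists (T j).adjoint (T i) := by
  obtain ⟨V, hV, hc, h1, h2⟩ := hT.exists_twist hij
  have hc' : ∀ k, Commute (star V) (T k) := fun k => commute_star_of_unitary hV (hc k)
  have hs : ∀ k, Commute V (star (T k)) := fun k => by simpa using (hc' k).star_star
  have hs' : ∀ k, Commute (star V) (star (T k)) := fun k => (hc k).star_star
  refine ⟨⟨star V, star V, ?_, hc' i, hs' i, h2⟩, ⟨V, V, ?_, hc i, hs i, ?_⟩⟩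
  · rw [mul_assoc, h1, mul_assoc, ← mul_assoc (star V), (Unitary.mem_iff.mp hV).1, one_mul]
  · have h3 := congrArg star h2
    simp only [star_mul, star_star] at h3
    rw [← ContinuousLinearMap.star_eq_adjoint, h3, ← (hs j).eq, ← mul_assoc, ← (hc i).eq]
  · have h3 := congrArg star h1
    simp only [star_mul] at h3
    rw [← ContinuousLinearMap.star_eq_adjoint, ← ContinuousLinearMap.star_eq_adjoint, mul_assoc,
      h3, ← mul_assoc (star (T i)), ← mul_assoc V, ((hs i).mul_right (hs j)).eq, mul_assoc,
      (Unitary.mem_iff.mp hV).2, mul_one]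

namespace IsDoublyTwisted

lemma reduces_level (hT : IsDoublyTwisted U T) {i j : Fin n} (hij : i ≠ j) (p : ℕ) :
    Reduces (T j) (level (T i) p) :=
  ⟨(hT.nearIsometry i).isClosed_level p, fun _ => (hT.twists hij).1.apply_mem_level,
    fun _ => (hT.twists hij).2.apply_mem_level⟩

lemma reduces_ker (hT : IsDoublyTwisted U T) {i j : Fin n} (hij : i ≠ j) :
    Reduces (T j) (T i).adjoint.ker :=
  level_zero (T := T i) ▸ hT.reduces_level hij 0

lemma reduces_core (hT : IsDoublyTwisted U T) (i j : Fin n) : Reduces (T j) (core (T i)) := by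
  rcases eq_or_ne i j with rfl | hij
  · exact (hT.nearIsometry i).reduces_core
  · exact ⟨(hT.nearIsometry i).isClosed_core, fun _ => (hT.twists hij).1.apply_mem_core,
      fun _ => (hT.twists hij).2.apply_mem_core⟩

lemma reduces_shiftPart (hT : IsDoublyTwisted U T) (i j : Fin n) :
    Reduces (T j) (shiftPart (T i)) :=
  (hT.nearIsometry i).core_orthogonal ▸ (hT.reduces_core i j).orthogonal

end IsDoublyTwisted

/-- The product `T_{e_1}^{k_1} ⋯ T_{e_m}^{k_m}`. -/
def powProd (T : Fin n → (H →L[ℂ] H)) {m : ℕ} (e : Fin m → Fin n) (k : Fin m → ℕ) : H →L[ℂ] H :=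
  (List.ofFn fun i => T (e i) ^ k i).prod

-- An arbitrary index map `e` allows induction on `m` by peeling off the leftmost factor; `opPow` is
-- definitionally the case where `e` is the increasing enumeration.
omit [CompleteSpace H] in
lemma powProd_succ {m : ℕ} (e : Fin (m + 1) → Fin n) (k : Fin (m + 1) → ℕ) :
    powProd T e k = T (e 0) ^ k 0 * powProd T (e ∘ Fin.succ) (k ∘ Fin.succ) := by
  simp [powProd, List.ofFn_succ]

omit [CompleteSpace H] in
lemma powProd_zero {m : ℕ} (e : Fin m → Fin n) : powProd T e 0 = 1 := by
  simp [powProd]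

omit [CompleteSpace H] in
lemma powProd_single {m : ℕ} (e : Fin m → Fin n) (r : Fin m) (p : ℕ) :
    powProd T e (Pi.single r p) = T (e r) ^ p := by
  induction m with
  | zero => exact r.elim0
  | succ m ih =>
    rw [powProd_succ]
    cases r using Fin.cases with
    | zero =>
      have : (Pi.single 0 p : Fin (m + 1) → ℕ) ∘ Fin.succ = 0 := by
        funext j
        simp
      rw [this, powProd_zero, mul_one, Pi.single_eq_same]
    | succ r =>
      have : (Pi.single r.succ p : Fin (m + 1) → ℕ) ∘ Fin.succ = Pi.single r p := by
        funext j
        simp [Pi.single_apply]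
      rw [this, ih, Pi.single_eq_of_ne (Fin.succ_ne_zero r).symm, pow_zero, one_mul]
      rfl

lemma iInf_fin_succ {α : Type*} [CompleteLattice α] {m : ℕ} (f : Fin (m + 1) → α) :
    ⨅ i, f i = f 0 ⊓ ⨅ i : Fin m, f i.succ :=
  le_antisymm (le_inf (iInf_le _ _) (le_iInf fun i => iInf_le _ i.succ))
    (le_iInf fun i => Fin.cases inf_le_left (fun i => inf_le_right.trans (iInf_le _ i)) i)

namespace IsDoublyTwisted

/-- Induction with `K` varying: `ker T_{e 0}*` is absorbed into `K`, where it reduces the later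
operators because `e` is injective. Their levels reduce `T_{e 0}` in turn, so its power only turns
its own kernel into a level. -/
lemma map_powProd (hT : IsDoublyTwisted U T) {m : ℕ} {e : Fin m → Fin n}
    (he : Function.Injective e) (k : Fin m → ℕ) {K : Submodule ℂ H}
    (hK : ∀ i, Reduces (T (e i)) K) :
    (K ⊓ ⨅ i, (T (e i)).adjoint.ker).map (powProd T e k).toLinearMap =
      K ⊓ ⨅ i, level (T (e i)) (k i) := by
  induction m generalizing K with
  | zero =>
    rw [Subsingleton.elim k 0, powProd_zero]
    rw [iInf_of_empty, iInf_of_empty, inf_top_eq]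
    exact Submodule.map_id K
  | succ m ih =>
    have hne : ∀ i : Fin m, e 0 ≠ e i.succ := fun i h => Fin.succ_ne_zero i (he h).symm
    have h1 := ih (e := e ∘ Fin.succ) (he.comp (Fin.succ_injective m)) (k ∘ Fin.succ)
      (K := K ⊓ (T (e 0)).adjoint.ker) fun i => (hK i.succ).inf (hT.reduces_ker (hne i))
    have h2 : Reduces (T (e 0)) (K ⊓ ⨅ i : Fin m, level (T (e i.succ)) (k i.succ)) :=
      (hK 0).inf (.iInf fun i => hT.reduces_level (hne i).symm _)
    have h3 := (hT.nearIsometry (e 0)).map_pow_inf_ker h2 (k 0)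
    rw [powProd_succ, iInf_fin_succ, iInf_fin_succ, ← inf_assoc]
    simp only [Function.comp_apply] at h1
    have h4 : (T (e 0) ^ k 0 * powProd T (e ∘ Fin.succ) (k ∘ Fin.succ)).toLinearMap =
        (T (e 0) ^ k 0).toLinearMap ∘ₗ
          (powProd T (e ∘ Fin.succ) (k ∘ Fin.succ)).toLinearMap := rfl
    rw [h4, Submodule.map_comp, h1, inf_right_comm, h3, inf_assoc, inf_comm (iInf _)]

lemma le_map_powProd (hT : IsDoublyTwisted U T) {m : ℕ} (e : Fin m → Fin n) (k : Fin m → ℕ)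
    {K : Submodule ℂ H} (hK : ∀ i, Reduces (T (e i)) K) (hcore : ∀ i, K ≤ core (T (e i))) :
    K ≤ K.map (powProd T e k).toLinearMap := by
  induction m with
  | zero =>
    rw [Subsingleton.elim k 0, powProd_zero]
    exact (Submodule.map_id K).ge
  | succ m ih =>
    intro x hx
    obtain ⟨y, hy, rfl⟩ :=
      (hT.nearIsometry (e 0)).exists_pow_of_le_core (hK 0) (hcore 0) (k 0) hx
    obtain ⟨z, hz, rfl⟩ := ih (e ∘ Fin.succ) (k ∘ Fin.succ) (fun i => hK i.succ)
      (fun i => hcore i.succ) hy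
    exact ⟨z, hz, by rw [powProd_succ]; rfl⟩

/-- Absorb `shiftPart (T (e i))` into `K` and expand the other indices first. Each resulting piece
is cut from `K` by levels reducing `T (e i)`, so `Reduces.inf_shiftPart` expands the last index. -/
lemma inf_shiftPart_le (hT : IsDoublyTwisted U T) {m : ℕ} {e : Fin m → Fin n}
    (he : Function.Injective e) (s : Finset (Fin m)) {K : Submodule ℂ H}
    (hK : ∀ i, Reduces (T (e i)) K) :
    K ⊓ ⨅ i ∈ s, shiftPart (T (e i)) ≤
      (⨆ k : Fin m → ℕ, K ⊓ ⨅ i ∈ s, level (T (e i)) (k i)).topologicalClosure := by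
  induction s using Finset.induction_on generalizing K with
  | empty =>
    simp only [Finset.notMem_empty, iInf_false, iInf_top, inf_top_eq, ciSup_const]
    exact Submodule.le_topologicalClosure _
  | insert i s hi ih =>
    rw [Finset.iInf_insert, ← inf_assoc]
    refine (ih fun j => (hK j).inf (hT.reduces_shiftPart _ _)).trans ?_
    refine Submodule.topologicalClosure_minimal _ (iSup_le fun k => ?_)
      (Submodule.isClosed_topologicalClosure _)
    have hred : Reduces (T (e i)) (K ⊓ ⨅ j ∈ s, level (T (e j)) (k j)) :=
      (hK i).inf <| .iInf fun j => .iInf fun hj =>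
        hT.reduces_level (fun h => hi ((he h : j = i) ▸ hj)) _
    rw [inf_right_comm, hred.inf_shiftPart]
    refine Submodule.topologicalClosure_mono (iSup_le fun p => ?_)
    refine le_iSup_of_le (Function.update k i p) ?_
    rw [Finset.iInf_insert, Function.update_self, inf_assoc, inf_comm (iInf _)]
    refine inf_le_inf_left _ (inf_le_inf_left _ (le_iInf₂ fun j hj => ?_))
    rw [Function.update_of_ne (fun h : j = i => hi (h ▸ hj))]
    exact iInf₂_le j hj

end IsDoublyTwisted

/-- The intersection of the cores of the `T_i`, `i ∉ A`. -/
def coreCompl (T : Fin n → (H →L[ℂ] H)) (A : Finset (Fin n)) : Submodule ℂ H :=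
  ⨅ i ∉ A, core (T i)

omit [CompleteSpace H] in
lemma coreCompl_le {A : Finset (Fin n)} {i : Fin n} (hi : i ∉ A) : coreCompl T A ≤ core (T i) :=
  iInf₂_le (f := fun i (_ : i ∉ A) => core (T i)) i hi

lemma iInf_mem_eq_iInf_orderEmb {α : Type*} [CompleteLattice α] (A : Finset (Fin n))
    (f : Fin n → α) : ⨅ i ∈ A, f i = ⨅ r, f (A.orderEmbOfFin rfl r) := by
  apply le_antisymm
  · exact le_iInf fun r => iInf₂_le _ (A.orderEmbOfFin_mem rfl r)
  · refine le_iInf₂ fun i hi => ?_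
    obtain ⟨r, rfl⟩ : i ∈ Set.range (A.orderEmbOfFin rfl) := by
      rwa [Finset.range_orderEmbOfFin]
    exact iInf_le _ r

/-- `woldPart T A i` is the shift part of `T_i` if `i ∈ A` and its core otherwise. -/
def woldPart (T : Fin n → (H →L[ℂ] H)) (A : Finset (Fin n)) (i : Fin n) : Submodule ℂ H :=
  if i ∈ A then shiftPart (T i) else core (T i)

namespace IsDoublyTwisted

lemma reduces_coreCompl (hT : IsDoublyTwisted U T) (A : Finset (Fin n)) (j : Fin n) :
    Reduces (T j) (coreCompl T A) :=
  .iInf fun i => .iInf fun _ => hT.reduces_core i j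

/-- Multi-indices supported at one place give the cores, and `l = 0` gives the kernels. Conversely
the right-hand side reduces the operators outside `A` and lies in their cores, so they map it onto
itself. -/
lemma wandering_eq (hT : IsDoublyTwisted U T) (A : Finset (Fin n)) :
    wandering T A = coreCompl T A ⊓ ⨅ r, (T (A.orderEmbOfFin rfl r)).adjoint.ker := by
  rw [← iInf_mem_eq_iInf_orderEmb A fun i => (T i).adjoint.ker]
  apply le_antisymm
  · intro x hx
    rw [wandering, Submodule.mem_iInf] at hx
    constructor
    · simp only [coreCompl, SetLike.mem_coe, Submodule.mem_iInf]
      intro i hi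
      obtain ⟨r, rfl⟩ : i ∈ Set.range (Aᶜ.orderEmbOfFin rfl) := by
        rw [Finset.range_orderEmbOfFin]
        simpa using hi
      rw [mem_core]
      intro p
      obtain ⟨y, -, hy⟩ := hx (Pi.single r p)
      have h : opPow T Aᶜ (Pi.single r p) = T (Aᶜ.orderEmbOfFin rfl r) ^ p :=
        powProd_single _ r p
      have hy' : opPow T Aᶜ (Pi.single r p) y = x := hy
      rw [h] at hy'
      exact ⟨y, hy'⟩
    · obtain ⟨y, hy, rfl⟩ := hx 0
      have : opPow T Aᶜ 0 = 1 := powProd_zero _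
      rw [this]
      exact hy
  · refine le_iInf fun l => ?_
    have hmem : ∀ r, Aᶜ.orderEmbOfFin rfl r ∉ A := fun r =>
      Finset.mem_compl.mp (Aᶜ.orderEmbOfFin_mem rfl r)
    refine (hT.le_map_powProd (Aᶜ.orderEmbOfFin rfl) l (fun r => ?_) fun r => ?_).trans
      (Submodule.map_mono inf_le_right)
    · refine (hT.reduces_coreCompl A _).inf (.iInf fun i => .iInf fun hi => hT.reduces_ker ?_)
      exact fun h => hmem r (h ▸ hi)
    · exact inf_le_left.trans (coreCompl_le (hmem r))

lemma block_eq (hT : IsDoublyTwisted U T) (A : Finset (Fin n)) (k : Fin A.card → ℕ) :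
    block T A k = coreCompl T A ⊓ ⨅ r, level (T (A.orderEmbOfFin rfl r)) (k r) := by
  rw [block, hT.wandering_eq]
  exact hT.map_powProd (A.orderEmbOfFin rfl).injective k fun r => hT.reduces_coreCompl A _

lemma woldSummand_eq (hT : IsDoublyTwisted U T) (A : Finset (Fin n)) :
    woldSummand T A = ⨅ i, woldPart T A i := by
  have h1 : ⨅ i, woldPart T A i =
      coreCompl T A ⊓ ⨅ r, shiftPart (T (A.orderEmbOfFin rfl r)) := by
    rw [← iInf_mem_eq_iInf_orderEmb A fun i => shiftPart (T i), coreCompl]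
    apply le_antisymm
    · refine le_inf (le_iInf₂ fun i hi => ?_) (le_iInf₂ fun i hi => ?_)
      · exact (iInf_le _ i).trans (by rw [woldPart, if_neg hi])
      · exact (iInf_le _ i).trans (by rw [woldPart, if_pos hi])
    · refine le_iInf fun i => ?_
      by_cases hi : i ∈ A
      · rw [woldPart, if_pos hi]
        exact inf_le_right.trans (iInf₂_le i hi)
      · rw [woldPart, if_neg hi]
        exact inf_le_left.trans (iInf₂_le i hi)
  rw [h1, woldSummand]
  simp_rw [hT.block_eq]
  apply le_antisymm
  · refine Submodule.topologicalClosure_minimal _ (iSup_le fun k => ?_) ?_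
    · exact inf_le_inf_left _ (iInf_mono fun r => level_le_shiftPart _)
    · rw [Submodule.coe_inf]
      exact (isClosed_iInf fun i => isClosed_iInf fun _ => (hT.nearIsometry i).isClosed_core).inter
        (isClosed_iInf fun r => isClosed_shiftPart)
  · have h2 := hT.inf_shiftPart_le (A.orderEmbOfFin rfl).injective Finset.univ
      fun r => hT.reduces_coreCompl A _
    simpa only [Finset.mem_univ, iInf_pos] using h2

lemma reduces_woldSummand (hT : IsDoublyTwisted U T) (A : Finset (Fin n)) (j : Fin n) :
    Reduces (T j) (woldSummand T A) := by
  rw [hT.woldSummand_eq]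
  refine .iInf fun i => ?_
  rw [woldPart]
  split_ifs
  exacts [hT.reduces_shiftPart i j, hT.reduces_core i j]

/-- Each piece indexed by `A` splits along `T_i` into a shift part, filed under `insert i A`, and a
core part, filed under `A.erase i`. -/
lemma mem_iSup_woldPart (hT : IsDoublyTwisted U T) (s : Finset (Fin n)) (x : H) :
    x ∈ ⨆ A : Finset (Fin n), ⨅ i ∈ s, woldPart T A i := by
  induction s using Finset.induction_on with
  | empty => simp
  | insert i s hi ih =>
    refine (iSup_le fun A y hy => ?_ :
      ⨆ A : Finset (Fin n), ⨅ i ∈ s, woldPart T A i ≤ _) ih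
    have hred : Reduces (T i) (⨅ j ∈ s, woldPart T A j) := by
      refine .iInf fun j => .iInf fun _ => ?_
      rw [woldPart]
      split_ifs
      exacts [hT.reduces_shiftPart j i, hT.reduces_core j i]
    obtain ⟨a, ⟨ha, ha'⟩, b, ⟨hb, hb'⟩, rfl⟩ :=
      (hT.nearIsometry i).exists_shiftPart_add_core hred hy
    -- Changing `A` only at `i ∉ s` leaves the conditions indexed by `s` untouched.
    have key : ∀ B : Finset (Fin n), (∀ j ≠ i, j ∈ B ↔ j ∈ A) →
        ∀ z ∈ ⨅ j ∈ s, woldPart T A j, z ∈ woldPart T B i →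
        z ∈ ⨆ A : Finset (Fin n), ⨅ j ∈ insert i s, woldPart T A j := by
      intro B hB z hz hz'
      refine Submodule.mem_iSup_of_mem B ?_
      rw [Finset.iInf_insert]
      refine ⟨hz', ?_⟩
      simp only [SetLike.mem_coe, Submodule.mem_iInf] at hz ⊢
      intro j hj
      have := hz j hj
      rw [woldPart] at this ⊢
      simpa only [hB j (fun h => hi (h ▸ hj))] using this
    refine Submodule.add_mem _ (key (insert i A) ?_ a ha ?_) (key (A.erase i) ?_ b hb ?_)
    · intro j hj
      simp [hj]
    · rwa [woldPart, if_pos (Finset.mem_insert_self i A)]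
    · intro j hj
      simp [hj]
    · rwa [woldPart, if_neg (Finset.notMem_erase i A)]

lemma woldSummand_isOrtho (hT : IsDoublyTwisted U T) {A B : Finset (Fin n)} (hAB : A ≠ B) :
    woldSummand T A ⟂ woldSummand T B := by
  obtain ⟨i, hi⟩ : ∃ i, ¬(i ∈ A ↔ i ∈ B) := by
    by_contra! h
    exact hAB (Finset.ext h)
  rw [hT.woldSummand_eq, hT.woldSummand_eq]
  refine Submodule.IsOrtho.mono (iInf_le _ i) (iInf_le _ i) ?_
  have h := (hT.nearIsometry i).shiftPart_isOrtho_core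
  rw [woldPart, woldPart]
  split_ifs with h1 h2 h2
  · exact absurd (iff_of_true h1 h2) hi
  · exact h
  · exact h.symm
  · exact absurd (iff_of_false h1 h2) hi

theorem isWoldDecomposition (hT : IsDoublyTwisted U T) :
    IsWoldDecomposition T (woldSummand T) where
  closed A := Submodule.isClosed_topologicalClosure _
  reducing A i x hx :=
    ⟨(hT.reduces_woldSummand A i).map_mem x hx, (hT.reduces_woldSummand A i).adjoint_mem x hx⟩
  orthogonal A B := hT.woldSummand_isOrtho
  span := by
    refine eq_top_iff.mpr fun x _ => ?_
    simp_rw [hT.woldSummand_eq]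
    simpa only [Finset.mem_univ, iInf_pos] using hT.mem_iSup_woldPart Finset.univ x
  shift A i hi := by
    refine (hT.nearIsometry i).isShiftOn (hT.reduces_woldSummand A i) ?_
    rw [hT.woldSummand_eq]
    exact (iInf_le _ i).trans (by rw [woldPart, if_pos hi])
  invertible A i hi := by
    refine (hT.nearIsometry i).isInvertibleOn (hT.reduces_woldSummand A i) ?_
    rw [hT.woldSummand_eq]
    exact (iInf_le _ i).trans (by rw [woldPart, if_neg hi])

lemma apply_mem_block_add_single (hT : IsDoublyTwisted U T) (A : Finset (Fin n))
    (k : Fin A.card → ℕ) (r : Fin A.card) {x : H} (hx : x ∈ block T A k) :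
    T (A.orderEmbOfFin rfl r) x ∈ block T A (k + Pi.single r 1) := by
  rw [hT.block_eq] at hx ⊢
  refine ⟨(hT.reduces_coreCompl A _).map_mem x hx.1, ?_⟩
  have hx2 := hx.2
  simp only [SetLike.mem_coe, Submodule.mem_iInf] at hx2 ⊢
  intro q
  rcases eq_or_ne q r with rfl | hq
  · rw [Pi.add_apply, Pi.single_eq_same]
    exact apply_mem_level_succ (hx2 q)
  · rw [Pi.add_apply, Pi.single_eq_of_ne hq, add_zero]
    exact (hT.reduces_level ((A.orderEmbOfFin rfl).injective.ne hq) _).map_mem x (hx2 q)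

lemma apply_mem_block (hT : IsDoublyTwisted U T) (A : Finset (Fin n)) (k : Fin A.card → ℕ)
    {s : Fin n} (hs : s ∉ A) {x : H} (hx : x ∈ block T A k) : T s x ∈ block T A k := by
  rw [hT.block_eq] at hx ⊢
  refine Reduces.map_mem ((hT.reduces_coreCompl A _).inf (.iInf fun r => hT.reduces_level ?_ _))
    x hx
  exact fun h => hs (h ▸ A.orderEmbOfFin_mem rfl r)

lemma block_isOrtho (hT : IsDoublyTwisted U T) (A : Finset (Fin n)) {k l : Fin A.card → ℕ}
    (hkl : k ≠ l) : block T A k ⟂ block T A l := by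
  obtain ⟨r, hr⟩ := Function.ne_iff.mp hkl
  rw [hT.block_eq, hT.block_eq]
  exact ((hT.nearIsometry _).level_isOrtho hr).mono (inf_le_right.trans (iInf_le _ r))
    (inf_le_right.trans (iInf_le _ r))

lemma isClosed_wandering (hT : IsDoublyTwisted U T) (A : Finset (Fin n)) :
    IsClosed (wandering T A : Set H) := by
  rw [hT.wandering_eq, Submodule.coe_inf]
  exact (isClosed_iInf fun i => isClosed_iInf fun _ => (hT.nearIsometry i).isClosed_core).inter
    (isClosed_iInf fun r => (T _).adjoint.isClosed_ker)

lemma powProd_bound (hT : IsDoublyTwisted U T) {m : ℕ} (e : Fin m → Fin n) (k : Fin m → ℕ) :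
    ∃ δ : ℝ, 0 < δ ∧ ∀ x, δ * ‖x‖ ≤ ‖powProd T e k x‖ := by
  induction m with
  | zero => exact ⟨1, one_pos, fun x => by simp [powProd]⟩
  | succ m ih =>
    obtain ⟨δ, hδ, h⟩ := ih (e ∘ Fin.succ) (k ∘ Fin.succ)
    obtain ⟨ε, hε, h'⟩ := (hT.nearIsometry (e 0)).pow_bound (k 0)
    refine ⟨ε * δ, mul_pos hε hδ, fun x => ?_⟩
    rw [powProd_succ, mul_assoc]
    exact (mul_le_mul_of_nonneg_left (h x) hε.le).trans (h' _)

end IsDoublyTwisted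

end Tuples

/-! ### Polar decomposition of operators that are bounded below -/

section Polar

variable {E H : Type*} [NormedAddCommGroup E] [InnerProductSpace ℂ E] [CompleteSpace E]
  [NormedAddCommGroup H] [InnerProductSpace ℂ H] [CompleteSpace H]

/-- With `P = (S* S)^{1/2}` invertible, `Λ = S P⁻¹`; it is isometric because `‖P x‖ = ‖S x‖`. -/
lemma exists_isPolarUnitary (S : E →L[ℂ] H) {δ : ℝ} (hδ : 0 < δ) (hS : ∀ x, δ * ‖x‖ ≤ ‖S x‖)
    {R : Submodule ℂ H} (hR : ∀ y, y ∈ R ↔ ∃ x, S x = y) :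
    ∃ Λ : E ≃ₗᵢ[ℂ] R, IsPolarUnitary S Λ := by
  have hG : 0 ≤ S.adjoint ∘L S :=
    (ContinuousLinearMap.nonneg_iff_isPositive _).mpr
      (ContinuousLinearMap.isPositive_adjoint_comp_self S)
  set P : E →L[ℂ] E := CFC.sqrt (S.adjoint ∘L S) with hP
  have hPpos : P.IsPositive :=
    (ContinuousLinearMap.nonneg_iff_isPositive _).mp (CFC.sqrt_nonneg _)
  have hPP : P * P = S.adjoint ∘L S := CFC.sqrt_mul_sqrt_self _ hG
  have hinner : ∀ x y, ⟪P (P x), y⟫_ℂ = ⟪S x, S y⟫_ℂ := fun x y => by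
    rw [← ContinuousLinearMap.adjoint_inner_left]
    exact congrArg (fun z => ⟪z, y⟫_ℂ) (DFunLike.congr_fun hPP x)
  have hnorm : ∀ x, ‖P x‖ = ‖S x‖ := fun x => by
    have h1 := hinner x x
    have h2 : ⟪P (P x), x⟫_ℂ = ⟪P x, P x⟫_ℂ := by
      conv_rhs => rw [← ContinuousLinearMap.adjoint_inner_left, hPpos.isSelfAdjoint.adjoint_eq]
    rw [h2, inner_self_eq_norm_sq_to_K, inner_self_eq_norm_sq_to_K] at h1
    have h3 : ‖P x‖ ^ 2 = ‖S x‖ ^ 2 := by exact_mod_cast h1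
    exact (sq_eq_sq₀ (norm_nonneg _) (norm_nonneg _)).mp h3
  -- `⟪P² x, x⟫ = ‖S x‖² ≥ δ² ‖x‖²`, so the quadratic form of `P²` is bounded below.
  have hunit : IsUnit (P * P) := by
    refine ContinuousLinearMap.isUnit_of_forall_le_norm_inner_map _ (c := (δ ^ 2).toNNReal)
      (by simpa using pow_pos hδ 2) fun x => ?_
    rw [mul_apply_eq_comp, hinner, Real.coe_toNNReal _ (by positivity),
      inner_self_eq_norm_sq_to_K, norm_pow, RCLike.norm_ofReal, abs_norm, ← mul_pow, mul_comm]
    exact pow_le_pow_left₀ (by positivity) (hS x) 2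
  have hPu : IsUnit P := (Commute.refl P).isUnit_mul_iff.mp hunit |>.1
  have hPb : Function.Bijective P := ContinuousLinearMap.isUnit_iff_bijective.mp hPu
  let Q : E ≃ₗ[ℂ] E := LinearEquiv.ofBijective P.toLinearMap hPb
  have hQ : ∀ x, Q x = P x := fun x => rfl
  let f : E →ₗᵢ[ℂ] R :=
    { toLinearMap := (S.toLinearMap ∘ₗ Q.symm.toLinearMap).codRestrict R
        fun x => (hR _).mpr ⟨Q.symm x, rfl⟩
      norm_map' := fun x => by
        change ‖S (Q.symm x)‖ = ‖x‖
        rw [← hnorm, ← hQ, LinearEquiv.apply_symm_apply] }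
  have hf : ∀ x, (f (P x) : H) = S x := fun x => by
    change S (Q.symm (P x)) = S x
    rw [← hQ, LinearEquiv.symm_apply_apply]
  have hsurj : Function.Surjective f := fun ⟨y, hy⟩ => by
    obtain ⟨x, rfl⟩ := (hR y).mp hy
    exact ⟨P x, Subtype.ext (hf x)⟩
  exact ⟨LinearIsometryEquiv.ofSurjective f hsurj, P, hPpos, hinner, hf⟩

end Polar

/-! ### The Hardy space as a Hilbert sum -/

section Hardy

lemma summable_prod_pow {m : ℕ} (r : Fin m → ℝ) (h0 : ∀ i, 0 ≤ r i) (h1 : ∀ i, r i < 1) :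
    Summable fun k : Fin m → ℕ => ∏ i, r i ^ k i := by
  induction m with
  | zero => exact (hasSum_unique _).summable
  | succ m ih =>
    rw [← (Fin.consEquiv fun _ : Fin (m + 1) => ℕ).summable_iff]
    have h2 := Summable.mul_of_nonneg (summable_geometric_of_lt_one (h0 0) (h1 0))
      (ih (r ∘ Fin.succ) (fun i => h0 _) fun i => h1 _) (fun p => pow_nonneg (h0 0) p)
      fun k => Finset.prod_nonneg fun i _ => pow_nonneg (h0 _) _
    refine h2.congr fun p => ?_
    simp [Fin.prod_univ_succ, Fin.consEquiv]

variable {m : ℕ} {E : Type*} [NormedAddCommGroup E] [InnerProductSpace ℂ E]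

lemma summable_norm_mpow_sq {z : Fin m → ℂ} (hz : z ∈ polydisc m) :
    Summable fun k => ‖mpow z k‖ ^ 2 := by
  refine (summable_prod_pow (fun i => ‖z i‖ ^ 2) (fun i => by positivity) fun i => ?_).congr
    fun k => ?_
  · exact pow_lt_one₀ (norm_nonneg _) (hz i) two_ne_zero
  · rw [mpow, norm_prod, ← Finset.prod_pow]
    exact Finset.prod_congr rfl fun i _ => by rw [norm_pow, pow_right_comm]

/-- Convergence follows from `‖z^k‖ ‖a_k‖ ≤ ‖z^k‖² + ‖a_k‖²`. This makes `coeff` surjective. -/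
lemma exists_isCoeff [CompleteSpace E] (a : CoeffSpace m E) :
    ∃ f : polydisc m → E, IsCoeff a f := by
  refine ⟨fun z => ∑' k, mpow z.1 k • a k, fun z => Summable.hasSum ?_⟩
  have ha : Summable fun k => ‖a k‖ ^ 2 := by
    simpa using (lp.memℓp a).summable (by norm_num)
  refine .of_norm_bounded ((summable_norm_mpow_sq z.2).add ha) fun k => ?_
  rw [norm_smul]
  nlinarith [sq_nonneg (‖mpow z.1 k‖ - ‖a k‖), sq_nonneg (‖mpow z.1 k‖), sq_nonneg ‖a k‖]

namespace HardySpace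

lemma coeff_monomial (k : Fin m → ℕ) (η : E) : coeff (monomial k η) = lp.single 2 k η :=
  (isCoeff_coeff _).unique (isCoeff_single k η)

variable (m E) in
/-- The Hardy space is isometric to the space of square-summable families of coefficients. -/
def coeffEquiv [CompleteSpace E] : HardySpace m E ≃ₗᵢ[ℂ] CoeffSpace m E :=
  LinearIsometryEquiv.ofSurjective ⟨coeff, fun _ => rfl⟩ fun a => by
    obtain ⟨f, hf⟩ := exists_isCoeff a
    exact ⟨⟨f, a, hf⟩, (isCoeff_coeff _).unique hf⟩

lemma coeffEquiv_symm_single [CompleteSpace E] (k : Fin m → ℕ) (η : E) :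
    (coeffEquiv m E).symm (lp.single 2 k η) = monomial k η := by
  rw [LinearIsometryEquiv.symm_apply_eq]
  exact (coeff_monomial k η).symm

/-- A closed subspace that is the Hilbert sum of copies `B k` of `E`, `k ∈ ℕ^m`, is isometric to the
Hardy space, the copy `B k` of `E` being sent to `z^k ⊗ E`. -/
theorem exists_equiv_of_blocks {H : Type*} [NormedAddCommGroup H] [InnerProductSpace ℂ H]
    [CompleteSpace H] [CompleteSpace E] {K : Submodule ℂ H} {B : (Fin m → ℕ) → Submodule ℂ H}
    (hle : ∀ k, B k ≤ K) (hspan : (⨆ k, B k).topologicalClosure = K)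
    (hB : ∀ k l, k ≠ l → B k ⟂ B l) (Λ : ∀ k, E ≃ₗᵢ[ℂ] B k) :
    ∃ V : K ≃ₗᵢ[ℂ] HardySpace m E, ∀ k η, V ⟨Λ k η, hle k (Λ k η).2⟩ = monomial k η := by
  have : CompleteSpace K := by
    rw [← hspan]
    exact (Submodule.isClosed_topologicalClosure _).completeSpace_coe
  let ι : ∀ k, E →ₗᵢ[ℂ] K := fun k =>
    ⟨Submodule.inclusion (hle k) ∘ₗ (Λ k).toLinearEquiv.toLinearMap, fun x => (Λ k).norm_map x⟩
  have hι : ∀ k η, (ι k η : H) = Λ k η := fun _ _ => rfl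
  have hsum : IsHilbertSum ℂ (fun _ : Fin m → ℕ => E) ι := by
    refine .mk ?_ ?_
    · intro k l hkl x y
      exact Submodule.isOrtho_iff_inner_eq.mp (hB k l hkl) _ (Λ k x).2 _ (Λ l y).2
    -- Totality: a vector of `K` orthogonal to all blocks is orthogonal to their closed span, which
    -- is `K`.
    · rw [top_le_iff, Submodule.topologicalClosure_eq_top_iff, Submodule.eq_bot_iff]
      intro x hx
      have h1 : (x : H) ∈ (⨆ k, B k).topologicalClosureᗮ := by
        rw [Submodule.orthogonal_closure, ← Submodule.iInf_orthogonal,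
          Submodule.mem_iInf]
        intro k b hb
        have h2 := hx (ι k ((Λ k).symm ⟨b, hb⟩)) (Submodule.mem_iSup_of_mem k ⟨_, rfl⟩)
        rw [Submodule.coe_inner, hι, LinearIsometryEquiv.apply_symm_apply] at h2
        exact h2
      rw [hspan] at h1
      exact Subtype.ext (eq_zero_of_mem_orthogonal x.2 h1)
  refine ⟨hsum.linearIsometryEquiv.trans (coeffEquiv m E).symm, fun k η => ?_⟩
  rw [LinearIsometryEquiv.trans_apply, ← coeffEquiv_symm_single]
  congr 1
  rw [← LinearIsometryEquiv.eq_symm_apply, hsum.linearIsometryEquiv_symm_apply_single]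
  rfl

end HardySpace

end Hardy

/-! ### The multishift model on a Wold summand -/

section Model

variable {n : ℕ} {H : Type*} [NormedAddCommGroup H] [InnerProductSpace ℂ H] [CompleteSpace H]
  {U : Fin n → Fin n → (H →L[ℂ] H)} {T : Fin n → (H →L[ℂ] H)} {A : Finset (Fin n)}

lemma IsDoublyTwisted.exists_polar (hT : IsDoublyTwisted U T) (A : Finset (Fin n))
    (k : Fin A.card → ℕ) : ∃ Λ : wandering T A ≃ₗᵢ[ℂ] block T A k,
      IsPolarUnitary ((opPow T A k).domRestrict (wandering T A)) Λ := by
  have : CompleteSpace (wandering T A) := (hT.isClosed_wandering A).completeSpace_coe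
  obtain ⟨δ, hδ, h⟩ := hT.powProd_bound (A.orderEmbOfFin rfl) k
  refine exists_isPolarUnitary ((opPow T A k).domRestrict (wandering T A)) hδ
    (fun x => h x) fun y => ?_
  constructor
  · rintro ⟨x, hx, rfl⟩
    exact ⟨⟨x, hx⟩, rfl⟩
  · rintro ⟨x, rfl⟩
    exact (toBlock T A k x).2

/-- The intertwining relation `Λ_l Γ = S Λ_k` for the weight `Γ`; both the norm bound and the action
on monomials rest on it. -/
lemma coe_apply_weight (Λ : ∀ k, wandering T A ≃ₗᵢ[ℂ] block T A k) (S : H →L[ℂ] H)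
    (k l : Fin A.card → ℕ) (h : Set.MapsTo S (block T A k) (block T A l)) (η : wandering T A) :
    (Λ l (weight Λ S k l h η) : H) = S (Λ k η) := by
  have : weight Λ S k l h η = (Λ l).symm ⟨S (Λ k η), h (Λ k η).2⟩ := rfl
  rw [this, LinearIsometryEquiv.apply_symm_apply]

lemma norm_weight_le (Λ : ∀ k, wandering T A ≃ₗᵢ[ℂ] block T A k) (S : H →L[ℂ] H)
    (k l : Fin A.card → ℕ) (h : Set.MapsTo S (block T A k) (block T A l)) :
    ‖weight Λ S k l h‖ ≤ ‖S‖ := by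
  refine ContinuousLinearMap.opNorm_le_bound _ (norm_nonneg _) fun η => ?_
  rw [← (Λ l).norm_map, ← (Λ k).norm_map η, Submodule.coe_norm, Submodule.coe_norm,
    coe_apply_weight]
  exact S.le_opNorm _

lemma IsNearIsometry.norm_le_one {S : H →L[ℂ] H} (hS : IsNearIsometry S) : ‖S‖ ≤ 1 := by
  obtain ⟨δ, -, h⟩ := hS.bounds
  exact ContinuousLinearMap.opNorm_le_bound _ zero_le_one fun x => by
    rw [one_mul]
    exact (h x).2

end Model

end NearIsom

end

theorem theorem1 {n : ℕ} {H : Type*} [NormedAddCommGroup H] [InnerProductSpace ℂ H]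
    [CompleteSpace H] (U : Fin n → Fin n → (H →L[ℂ] H)) (T : Fin n → (H →L[ℂ] H))
    (hT : NearIsom.IsDoublyTwisted U T) (A : Finset (Fin n)) (hA : A.Nonempty) :
    NearIsom.IsWoldDecomposition T (NearIsom.woldSummand T) ∧
    ∃ (hinv : ∀ s, Set.MapsTo (T s) (NearIsom.woldSummand T A) (NearIsom.woldSummand T A))
      (hshift : ∀ k i, Set.MapsTo (T (A.orderEmbOfFin rfl i))
        (NearIsom.block T A k) (NearIsom.block T A (k + Pi.single i 1)))
      (hdiag : ∀ k, ∀ s ∉ A, Set.MapsTo (T s) (NearIsom.block T A k) (NearIsom.block T A k))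
      (Λ : ∀ k, NearIsom.wandering T A ≃ₗᵢ[ℂ] NearIsom.block T A k)
      (M : Fin n → (NearIsom.HardySpace A.card (NearIsom.wandering T A) →L[ℂ]
        NearIsom.HardySpace A.card (NearIsom.wandering T A)))
      (V : NearIsom.woldSummand T A ≃ₗᵢ[ℂ]
        NearIsom.HardySpace A.card (NearIsom.wandering T A)),
      (∀ k, NearIsom.IsPolarUnitary
        ((NearIsom.opPow T A k).domRestrict (NearIsom.wandering T A)) (Λ k)) ∧
      (∀ k η, V (NearIsom.toSummand T A k η) =
        NearIsom.HardySpace.monomial k ((Λ k).symm (NearIsom.toBlock T A k η))) ∧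
      (∀ s f, V ((T s).restrict (hinv s) (V.symm f)) = M s f) ∧
      NearIsom.HardySpace.IsMultishift
        (fun k i => NearIsom.weight Λ (T (A.orderEmbOfFin rfl i)) k (k + Pi.single i 1)
          (hshift k i))
        (fun i => M (A.orderEmbOfFin rfl i)) ∧
      ∀ s, ∀ hs : s ∉ A, NearIsom.HardySpace.IsBlockDiagonal
        (fun k => NearIsom.weight Λ (T s) k k (hdiag k s hs)) (M s) := by
  open NearIsom in
  have hinv : ∀ s, Set.MapsTo (T s) (woldSummand T A) (woldSummand T A) :=
    fun s => (hT.reduces_woldSummand A s).map_mem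
  have : CompleteSpace (wandering T A) := (hT.isClosed_wandering A).completeSpace_coe
  choose Λ hΛ using hT.exists_polar A
  obtain ⟨V, hV⟩ := HardySpace.exists_equiv_of_blocks (block_le_woldSummand T A) rfl
    (fun k l => hT.block_isOrtho A) Λ
  -- Defining `M s` by conjugation with `V` makes it bounded and the intertwining definitional; only
  -- its action on monomials needs proof.
  let M : Fin n → (HardySpace A.card (wandering T A) →L[ℂ] HardySpace A.card (wandering T A)) :=
    fun s => (V : woldSummand T A →L[ℂ] HardySpace A.card (wandering T A)) ∘L
      (T s).restrict (hinv s) ∘L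
      (V.symm : HardySpace A.card (wandering T A) →L[ℂ] woldSummand T A)
  -- One formula serves both cases: `l = k + e_i` for the multishift and `l = k` for the
  -- block-diagonal operators.
  have hM : ∀ s k l (h : Set.MapsTo (T s) (block T A k) (block T A l)) (η : wandering T A),
      M s (HardySpace.monomial k η) = HardySpace.monomial l (weight Λ (T s) k l h η) := by
    intro s k l h η
    change V ((T s).restrict (hinv s) (V.symm (HardySpace.monomial k η))) = _
    rw [← hV, ← hV, LinearIsometryEquiv.symm_apply_apply]
    exact congrArg V (Subtype.ext (coe_apply_weight Λ (T s) k l h η).symm)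
  have hb : ∀ s k l (h : Set.MapsTo (T s) (block T A k) (block T A l)),
      ‖weight Λ (T s) k l h‖ ≤ 1 := fun s k l h =>
    (norm_weight_le Λ (T s) k l h).trans (hT.nearIsometry s).norm_le_one
  refine ⟨hT.isWoldDecomposition, hinv, fun k i x => hT.apply_mem_block_add_single A k i,
    fun k s hs x => hT.apply_mem_block A k hs, Λ, M, V, hΛ, fun k η => ?_, fun s f => rfl,
    ⟨⟨1, fun k i => hb _ _ _ _⟩, fun i k η => hM _ _ _ _ η⟩,
    fun s hs => ⟨⟨1, fun k => hb _ _ _ _⟩, fun k η => hM _ _ _ _ η⟩⟩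
  rw [← hV]
  refine congrArg V (Subtype.ext ?_)
  rw [LinearIsometryEquiv.apply_symm_apply]
  rfl
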